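/- Let $\mathbf F_r$ be the free group on $x_1,\dots,x_r$ and let $w_1,\dots,w_\ell\in\mathbf F_r$, written as reduced words. For $n\ge 0$ let $$\mathrm{Tr}_{w_1,\dots,w_\ell}(n)=\mathbb E\big[\mathrm{tr}(w_1(U_1,\dots,U_r))\cdots \mathrm{tr}(w_\ell(U_1,\dots,U_r))\big],$$ where $U_1,\dots,U_r$ are independent Haar-distributed random matrices in the group $\mathcal U(n)$ of $n\times n$ unitary matrices, $w_j(U_1,\dots,U_r)$ is obtained by substituting $U_i$ for $x_i$ in $w_j$, and $\mathrm{tr}$ is the usual trace. Assume that the words are balanced: for every $i$, the number $L_i$ of appearances of $x_i^{+1}$ in $w_1,\dots,w_\ell$ equals the number of appearances of $x_i^{-1}$. Let $\mathrm{BIJ}_i$ be the set of bijections from the appearances of $x_i^{+1}$ to the appearances of $x_i^{-1}$. For a finite set $A$ let $\mathrm{Wg}:\mathrm{Sym}(A)\to\mathbb Q(n)$ be the Weingarten function, the inverse of the function $\sigma\mapsto n^{\#\mathrm{cycles}(\sigma)}$ (fixed points count as cycles) in the group ring $\mathbb Q(n)[\mathrm{Sym}(A)]$; for $\sigma_i,\tau_i\in\mathrm{BIJ}_i$,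 $\mathrm{Wg}(\sigma_i^{-1}\tau_i)$ is taken for the set $A$ of appearances of $x_i^{+1}$. Attach an index to every letter $p$ of the words, called its first index; its second index is the first index of the cyclically next letter $p^+$ of the same word. For $\sigma_i,\tau_i\in\mathrm{BIJ}_i$ $(1\le i\le r)$ let $B(\sigma_1,\tau_1,\dots,\sigma_r,\tau_r)$ be the number of blocks of the finest partition of the indices such that, for every $i$ and every appearance $p$ of $x_i^{+1}$, the first index of $p$ lies in the same block as the second index of $\sigma_i(p)$, and the second index of $p$ lies in the same block as the first index of $\tau_i(p)$. Let $t$ be the number of $j$ with $w_j=1$. Then for every $n$ with $n\ge L_i$ for all $i$, none of the rational functions $\mathrm{Wg}(\sigma_i^{-1}\tau_i)$ has a pole at $n$, and $$\mathrm{Tr}_{w_1,\dots,w_\ell}(n)=\sum_{\sigma_1,\tau_1\in \mathrm{BIJ}_1,\dots,\sigma_r,\tau_r\in \mathrm{BIJ}_r}\mathrm{Wg}(\sigma_1^{-1}\tau_1)\cdots \mathrm{Wg}(\sigma_r^{-1}\tau_r)\; n^{B(\sigma_1,\tau_1,\dots,\sigma_r,\tau_r)+t}.$$ In particular, there is one rational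 function $R\in\mathbb Q(n)$ such that for all integers $n\ge\max_i L_i$, $R$ has no pole at $n$ and $\mathrm{Tr}_{w_1,\dots,w_\ell}(n)=R(n)$. -/

import Mathlib

open MeasureTheory

noncomputable section

namespace WordTrace

/-! ### Haar measure on the unitary group -/

/-- The group `U(n)` of `n × n` complex unitary matrices. -/
abbrev U (n : ℕ) : Type := Matrix.unitaryGroup (Fin n) ℂ

instance (n : ℕ) : CompactSpace (U n) := by
  have hK : IsCompact (Set.pi Set.univ fun _ : Fin n =>
      (Set.pi Set.univ fun _ : Fin n => Metric.closedBall (0 : ℂ) 1)) :=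
    isCompact_univ_pi fun _ => isCompact_univ_pi fun _ => isCompact_closedBall _ _
  have hclosed : IsClosed ((Matrix.unitaryGroup (Fin n) ℂ : Set (Matrix (Fin n) (Fin n) ℂ))) := by
    have h : (Matrix.unitaryGroup (Fin n) ℂ : Set (Matrix (Fin n) (Fin n) ℂ)) =
        {A | A * star A = 1} := by
      ext A
      exact Matrix.mem_unitaryGroup_iff
    rw [h]
    exact isClosed_eq (by fun_prop) continuous_const
  refine isCompact_iff_compactSpace.mp (IsCompact.of_isClosed_subset hK hclosed ?_)
  intro A hA i _ j _
  simpa using entry_norm_bound_of_unitary hA i j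

instance (n : ℕ) : SecondCountableTopology (U n) := by
  have : SecondCountableTopology (Matrix (Fin n) (Fin n) ℂ) :=
    inferInstanceAs (SecondCountableTopology (Fin n → Fin n → ℂ))
  exact inferInstanceAs (SecondCountableTopology
    ((Matrix.unitaryGroup (Fin n) ℂ : Set (Matrix (Fin n) (Fin n) ℂ))))

instance (n : ℕ) : MeasurableSpace (U n) := borel _

instance (n : ℕ) : BorelSpace (U n) := ⟨rfl⟩

/-- The Haar measure `μ_n` of total mass one on `U(n)`. -/
def haarU (n : ℕ) : Measure (U n) :=
  Measure.haarMeasure (⊤ : TopologicalSpace.PositiveCompacts (U n))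

instance (n : ℕ) : IsProbabilityMeasure (haarU n) :=
  ⟨by simpa [haarU] using Measure.haarMeasure_self (K₀ := (⊤ : TopologicalSpace.PositiveCompacts (U n)))⟩

/-! ### Expected products of traces -/

/-- The random variable `tr (w₁(u)) ⋯ tr (w_ℓ(u))`, where `w_j(u)` is obtained from the word `w_j`
by substituting the unitary matrices `u₁, …, u_r` for the generators `x₁, …, x_r`. -/
def traceProd {r ℓ : ℕ} (w : Fin ℓ → FreeGroup (Fin r)) (n : ℕ) (u : Fin r → U n) : ℂ :=
  ∏ j, Matrix.trace (FreeGroup.lift u (w j) : U n).1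

/-- The expected value `Tr_{w₁,…,w_ℓ}(n)` of the product of the traces, for independent
Haar-distributed unitary matrices. -/
def expectedTrace {r ℓ : ℕ} (w : Fin ℓ → FreeGroup (Fin r)) (n : ℕ) : ℂ :=
  ∫ u, traceProd w n u ∂(Measure.pi fun _ : Fin r => haarU n)

theorem continuous_traceProd {r ℓ : ℕ} (w : Fin ℓ → FreeGroup (Fin r)) (n : ℕ) :
    Continuous (traceProd w n) := by
  have h : ∀ v : FreeGroup (Fin r),
      Continuous fun u : Fin r → U n => (FreeGroup.lift u v : U n) := by
    intro v
    induction v using FreeGroup.induction_on with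
    | C1 => simpa using continuous_const
    | of i => simpa using continuous_apply i
    | inv_of i _ =>
      simp only [map_inv, FreeGroup.lift_apply_of]
      exact (continuous_apply i).inv
    | mul x y hx hy =>
      simp only [map_mul]
      exact hx.mul hy
  unfold traceProd
  exact continuous_finsetProd _ fun j _ =>
    (continuous_subtype_val.comp (h (w j))).matrix_trace

/-- The expectation defining `expectedTrace` exists. -/
theorem integrable_traceProd {r ℓ : ℕ} (w : Fin ℓ → FreeGroup (Fin r)) (n : ℕ) :
    Integrable (traceProd w n) (Measure.pi fun _ : Fin r => haarU n) :=
  (continuous_traceProd w n).integrable_of_hasCompactSupport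
    (HasCompactSupport.of_compactSpace _)

/-! ### The Weingarten function -/

section Weingarten

variable {α : Type*} [Fintype α] [DecidableEq α]

/-- The number of cycles of a permutation, fixed points included. -/
def numCycles (σ : Equiv.Perm α) : ℕ := Multiset.card σ.partition.parts

variable (α) in
/-- The function `σ ↦ n ^ #cycles(σ)`, as an element of the group ring `ℚ(n)[Sym(α)]`; the
variable `n` is `RatFunc.X`. -/
def cycleElement : MonoidAlgebra (RatFunc ℚ) (Equiv.Perm α) :=
  ∑ σ : Equiv.Perm α, MonoidAlgebra.single σ (RatFunc.X ^ numCycles σ)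

theorem numCycles_one : numCycles (1 : Equiv.Perm α) = Fintype.card α := by
  simp [numCycles, Equiv.Perm.parts_partition]

theorem numCycles_lt {σ : Equiv.Perm α} (hσ : σ ≠ 1) : numCycles σ < Fintype.card α := by
  have h1 : σ.support.card ≤ Fintype.card α := Finset.card_le_univ _
  have h2 : 2 * Multiset.card σ.cycleType ≤ σ.support.card := by
    rw [← Equiv.Perm.sum_cycleType, mul_comm, ← smul_eq_mul]
    exact Multiset.card_nsmul_le_sum fun x hx => Equiv.Perm.two_le_of_mem_cycleType hx
  have h3 : 0 < Multiset.card σ.cycleType := Equiv.Perm.card_cycleType_pos.mpr hσ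
  simp only [numCycles, Equiv.Perm.parts_partition, Multiset.card_add, Multiset.card_replicate]
  omega

variable (α) in
/-- The element `cycleElement` is invertible, so that the Weingarten function is well defined. -/
theorem isUnit_cycleElement : IsUnit (cycleElement α) := by
  classical
  have hinj : ∀ b : MonoidAlgebra (RatFunc ℚ) (Equiv.Perm α), cycleElement α * b = 0 → b = 0 := by
    intro b hb
    by_contra hne
    let v := RatFunc.inftyValuation ℚ
    obtain ⟨σ₀, -, hmax⟩ := Finset.exists_max_image Finset.univ
      (fun σ : Equiv.Perm α => v (b.coeff σ)) Finset.univ_nonempty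
    have hcoef : ∑ τ : Equiv.Perm α,
        (RatFunc.X : RatFunc ℚ) ^ numCycles τ * b.coeff (τ⁻¹ * σ₀) = 0 := by
      have := congrArg (fun z => z.coeff σ₀) hb
      simpa [cycleElement, Finset.sum_mul, MonoidAlgebra.coeff_single_mul_apply] using this
    have hb0 : v (b.coeff σ₀) ≠ 0 := by
      intro h0
      apply hne
      ext σ
      have h := hmax σ (Finset.mem_univ _)
      rw [h0] at h
      simpa using (Valuation.zero_iff v).mp (le_antisymm h zero_le)
    have hX : v RatFunc.X = WithZero.exp (1 : ℤ) := RatFunc.inftyValuation.X ℚ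
    have hX1 : (1 : WithZero (Multiplicative ℤ)) < v RatFunc.X := by
      rw [hX, ← WithZero.exp_zero, WithZero.exp_lt_exp]; norm_num
    rw [← Finset.add_sum_erase _ _ (Finset.mem_univ (1 : Equiv.Perm α))] at hcoef
    have hlead : v (RatFunc.X ^ numCycles (1 : Equiv.Perm α) * b.coeff ((1 : Equiv.Perm α)⁻¹ * σ₀))
        = v RatFunc.X ^ Fintype.card α * v (b.coeff σ₀) := by
      simp [numCycles_one]
    have hlead0 : v RatFunc.X ^ Fintype.card α * v (b.coeff σ₀) ≠ 0 :=
      mul_ne_zero (pow_ne_zero _ (ne_of_gt (lt_trans zero_lt_one hX1))) hb0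
    have hrest : v (∑ τ ∈ Finset.univ.erase (1 : Equiv.Perm α),
        (RatFunc.X : RatFunc ℚ) ^ numCycles τ * b.coeff (τ⁻¹ * σ₀))
        < v RatFunc.X ^ Fintype.card α * v (b.coeff σ₀) := by
      refine Valuation.map_sum_lt v hlead0 fun τ hτ => ?_
      rw [map_mul, map_pow]
      calc v RatFunc.X ^ numCycles τ * v (b.coeff (τ⁻¹ * σ₀))
          ≤ v RatFunc.X ^ numCycles τ * v (b.coeff σ₀) :=
            mul_le_mul_right (hmax _ (Finset.mem_univ _)) _
        _ < _ := by
            refine mul_lt_mul_of_pos_right ?_ (zero_lt_iff.mpr hb0)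
            exact pow_lt_pow_right₀ hX1 (numCycles_lt (Finset.ne_of_mem_erase hτ))
    have := v.map_add_eq_of_lt_left (hlead ▸ hrest)
    rw [hcoef, map_zero, hlead] at this
    exact hlead0 this.symm
  have hsurj : Function.Surjective (LinearMap.mulLeft (RatFunc ℚ) (cycleElement α)) := by
    apply LinearMap.injective_iff_surjective.mp
    rw [injective_iff_map_eq_zero]
    exact hinj
  obtain ⟨b, hb⟩ := hsurj 1
  exact IsUnit.of_mul_eq_one b hb

/-- The Weingarten function on the symmetric group of `α`: the inverse of `σ ↦ n ^ #cycles(σ)` in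
the group ring `ℚ(n)[Sym(α)]`. -/
def weingarten (σ : Equiv.Perm α) : RatFunc ℚ :=
  ((isUnit_cycleElement α).unit⁻¹).val.coeff σ

end Weingarten

/-! ### Letters, matchings and the induced partition of the indices -/

section Words

variable {r ℓ : ℕ} (w : Fin ℓ → FreeGroup (Fin r))

/-- The positions of the letters of the reduced words `w₁, …, w_ℓ`. -/
abbrev Letter : Type := (j : Fin ℓ) × Fin (w j).toWord.length

/-- The letter at a given position: `(i, true)` stands for `x_i` and `(i, false)` for `x_i⁻¹`. -/
abbrev letterAt (p : Letter w) : Fin r × Bool := (w p.1).toWord.get p.2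

/-- The appearances of `x_i` with exponent `+1`. -/
abbrev Pos (i : Fin r) : Type := {p : Letter w // letterAt w p = (i, true)}

/-- The appearances of `x_i` with exponent `-1`. -/
abbrev Neg (i : Fin r) : Type := {p : Letter w // letterAt w p = (i, false)}

/-- The words are balanced: every `x_i` appears as often with exponent `+1` as with exponent `-1`,
in all the words together. -/
def Balanced : Prop := ∀ i : Fin r, Fintype.card (Pos w i) = Fintype.card (Neg w i)

/-- Bijections from the appearances of `x_i` to the appearances of `x_i⁻¹`. -/
abbrev Bij (i : Fin r) : Type := Pos w i ≃ Neg w i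

/-- The cyclically next letter of the same word. -/
def next (p : Letter w) : Letter w := ⟨p.1, finRotate _ p.2⟩

/-- The identifications of the indices imposed by the bijections. Expanding the traces gives one
summation index per letter: the letter at position `p` contributes the matrix entry with first index
`p` and second index `next p` (of `u_i`, or of `u_i⁻¹`, whose `(a, b)` entry is the conjugate of the
`(b, a)` entry of `u_i`). The bijection `σ_i` identifies the row index of `u_i`, that is the first
index of an appearance of `x_i` and the second index of its image; the bijection `τ_i` identifies
the column index, that is the second index of an appearance of `x_i` and the first index of its
image. -/
inductive IndexRel (σ τ : ∀ i, Bij w i) : Letter w → Letter w → Prop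
  | row (i : Fin r) (p : Pos w i) : IndexRel σ τ p.1 (next w (σ i p).1)
  | col (i : Fin r) (p : Pos w i) : IndexRel σ τ (next w p.1) (τ i p).1

/-- The number `B(σ₁, τ₁, …, σ_r, τ_r)` of blocks of the partition of the indices that is induced by
the bijections. -/
def numBlocks (σ τ : ∀ i, Bij w i) : ℕ := Nat.card (Quot (IndexRel w σ τ))

/-- The number of words that are trivial. A trivial word has no letters, but its trace is a sum over
one free index. -/
def numTrivial : ℕ := Fintype.card {j : Fin ℓ // w j = 1}

end Words

end WordTrace

end

/-!
The expected trace is computed by expanding the traces and integrating entry by entry. Expanding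
each trace as a sum over closed walks gives one index per letter (`traceProd_eq_sum`), and
independence splits the expectation into one Haar integral of entries and conjugate entries for each
generator (`expectedTrace_eq_sum`). Each such integral is given by the Weingarten formula
(`integral_prod_entries`) as a sum over pairs of bijections `σ`, `τ` of `Wg(σ⁻¹τ)` times the indicator
that row indices match along `σ` and column indices along `τ`. Exchanging the sums, the number of
assignments of values to the indices that satisfy all these equalities is `n ^ numBlocks`
(`sum_indexRel`).

The Weingarten formula is proved for `n ≥ #κ`, where `κ` is the set of factors, in three steps.

* Invariance of the Haar measure under left and right translation makes the matrices of moments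
  commute with the tensor powers `V^{⊗ κ}` of all unitary `V`. Since `n ≥ #κ`, there is a tensor of
  distinct basis vectors, and a direct argument replaces general Schur–Weyl duality: such a matrix is
  a linear combination of permutations (`eq_sum_perm_of_commute_unitary`). The key point is that the
  zero-one matrix of a map `Fin n → Fin n` is the product of a diagonal and a unitary matrix, and that
  commuting with the diagonal unitary matrices implies commuting with all diagonal matrices.
* Contracting the column indices along a permutation (`sum_haarMoment_comp_perm`) gives a linear
  system for the coefficients, with matrix `n ^ #cycles(σ⁻¹τ)`; the Weingarten function solves the
  same system (`haarMoment_coefficient`).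
* That matrix is the Gram matrix of the permutation operators, which are linearly independent for
  `n ≥ #κ`, so its determinant does not vanish at `n` (`eval_det_gramMatrix_ne_zero`). By Cramer's
  rule the Weingarten function then has no pole at `n` (`regularAt_weingarten`), and the identity
  that defines it can be evaluated there.

As the rational functions with no pole at `n` are closed under sums and products, and evaluation
respects these, the formula itself is the value of a single rational function.
-/

noncomputable section

namespace WordTrace

/-! ### Cycles of a permutation and fixed colourings -/

section Counting

variable {α : Type*}

/-- A map that is compatible with the relation `s` assigns a value to each block of the partition
that `s` generates. -/
theorem card_factoring_through_quot [Finite α] (s : α → α → Prop) (n : ℕ) :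
    Nat.card {f : α → Fin n // ∀ x y, s x y → f x = f y} = n ^ Nat.card (Quot s) := by
  have e : {f : α → Fin n // ∀ x y, s x y → f x = f y} ≃ (Quot s → Fin n) :=
    { toFun := fun f => Quot.lift f.1 f.2
      invFun := fun g => ⟨fun x => g (Quot.mk s x), fun x y h => congrArg g (Quot.sound h)⟩
      left_inv := fun f => rfl
      right_inv := fun g => by ext q; induction q using Quot.ind; rfl }
  have : Finite (Quot s) := Quot.finite s
  rw [Nat.card_congr e, Nat.card_fun, Nat.card_fin]

variable [Fintype α] [DecidableEq α]

/-- The cycles of a permutation, fixed points included, are the classes of the equivalence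
relation that it generates. -/
theorem numCycles_eq_card_quot (σ : Equiv.Perm α) :
    numCycles σ = Nat.card (Quot fun x y => σ x = y) := by
  classical
  let F : α → σ.cycleFactorsFinset ⊕ {x // x ∉ σ.support} := fun x =>
    if h : x ∈ σ.support then
      Sum.inl ⟨σ.cycleOf x, Equiv.Perm.cycleOf_mem_cycleFactorsFinset_iff.mpr h⟩
    else Sum.inr ⟨x, h⟩
  have hF : ∀ x y, F x = F y ↔ σ.SameCycle x y := by
    intro x y
    by_cases hx : x ∈ σ.support
    · by_cases hy : y ∈ σ.support
      · simp only [F, hx, hy, dif_pos, Sum.inl.injEq, Subtype.mk.injEq]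
        exact (Equiv.Perm.sameCycle_iff_cycleOf_eq_of_mem_support hx hy).symm
      · simp only [F, hx, hy, dif_pos, dif_neg, not_false_eq_true, reduceCtorEq, false_iff]
        exact fun h => hy (h.mem_support_iff.mp hx)
    · by_cases hy : y ∈ σ.support
      · simp only [F, hx, hy, dif_pos, dif_neg, not_false_eq_true, reduceCtorEq, false_iff]
        exact fun h => hx (h.mem_support_iff.mpr hy)
      · simp only [F, hx, hy, dif_neg, not_false_eq_true, Sum.inr.injEq, Subtype.mk.injEq]
        refine ⟨fun h => h ▸ Equiv.Perm.SameCycle.refl _ _, fun h => ?_⟩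
        exact h.eq_of_left (Equiv.Perm.notMem_support.mp hx)
  have hsurj : Function.Surjective F := by
    rintro (⟨c, hc⟩ | ⟨x, hx⟩)
    · obtain ⟨x, hx⟩ := (Equiv.Perm.mem_cycleFactorsFinset_iff.mp hc).1.nonempty_support
      refine ⟨x, ?_⟩
      have hxσ : x ∈ σ.support := Equiv.Perm.mem_cycleFactorsFinset_support_le hc hx
      simp only [F, hxσ, dif_pos, Sum.inl.injEq, Subtype.mk.injEq]
      exact (Equiv.Perm.cycle_is_cycleOf hx hc).symm
    · exact ⟨x, by simp only [F, dif_neg hx]⟩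
  have hstep : ∀ x y, σ x = y → F x = F y := fun x y h =>
    (hF x y).mpr (h ▸ Equiv.Perm.sameCycle_apply_right.mpr (Equiv.Perm.SameCycle.refl _ _))
  have hpow : ∀ (k : ℕ) (x : α),
      (Quot.mk (fun x y => σ x = y) x : Quot _) = Quot.mk _ ((σ ^ k) x) := by
    intro k
    induction k with
    | zero => intro x; rfl
    | succ k ih =>
      intro x
      rw [pow_succ', Equiv.Perm.mul_apply]
      exact (ih x).trans (Quot.sound rfl)
  have hbij : Function.Bijective (Quot.lift F hstep) := by
    constructor
    · intro a b
      induction a using Quot.ind with | mk x => ?_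
      induction b using Quot.ind with | mk y => ?_
      intro h
      obtain ⟨k, hk⟩ := ((hF x y).mp h).exists_nat_pow_eq
      rw [hpow k x, hk]
    · intro z
      obtain ⟨x, hx⟩ := hsurj z
      exact ⟨Quot.mk _ x, hx⟩
  rw [Nat.card_congr (Equiv.ofBijective _ hbij), Nat.card_sum, Nat.card_eq_fintype_card,
    Nat.card_eq_fintype_card, Fintype.card_coe, Fintype.card_subtype_compl, Fintype.card_coe,
    numCycles, Equiv.Perm.parts_partition, Multiset.card_add, Multiset.card_replicate,
    Equiv.Perm.cycleType_def, Multiset.card_map]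
  rfl

theorem sum_ite_comp_perm_eq {R : Type*} [CommSemiring R] (n : ℕ) (σ : Equiv.Perm α) :
    (∑ b : α → Fin n, if b ∘ σ = b then (1 : R) else 0) = (n : R) ^ numCycles σ := by
  classical
  rw [Finset.sum_boole, numCycles_eq_card_quot, ← Nat.cast_pow, ← card_factoring_through_quot]
  congr 1
  rw [← Fintype.card_subtype, ← Nat.card_eq_fintype_card]
  refine Nat.card_congr (Equiv.subtypeEquivRight fun f => ?_)
  constructor
  · rintro h x y rfl
    exact (congrFun h x).symm
  · intro h
    funext x
    exact (h x _ rfl).symm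

theorem numCycles_inv (σ : Equiv.Perm α) : numCycles σ⁻¹ = numCycles σ := by
  simp [numCycles, Equiv.Perm.parts_partition]

theorem numCycles_mul_comm (σ τ : Equiv.Perm α) : numCycles (σ * τ) = numCycles (τ * σ) := by
  have h : σ * τ = σ * (τ * σ) * σ⁻¹ := by group
  rw [h]
  simp [numCycles, Equiv.Perm.parts_partition, Equiv.Perm.cycleType_conj]

end Counting

/-! ### Rational functions without a pole at an integer -/

section Regular

/-- The rational function `f` has no pole at `n`. -/
def RegularAt (n : ℕ) (f : RatFunc ℚ) : Prop := f.denom.eval (n : ℚ) ≠ 0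

/-- The value of the rational function `f` at `n`, as a complex number. -/
def value (n : ℕ) (f : RatFunc ℚ) : ℂ := f.eval (algebraMap ℚ ℂ) (n : ℂ)

theorem eval₂_natCast (n : ℕ) (p : Polynomial ℚ) :
    p.eval₂ (algebraMap ℚ ℂ) (n : ℂ) = algebraMap ℚ ℂ (p.eval (n : ℚ)) := by
  rw [← map_natCast (algebraMap ℚ ℂ) n, Polynomial.eval₂_at_apply]

theorem RegularAt.eval₂_ne_zero {n : ℕ} {f : RatFunc ℚ} (h : RegularAt n f) :
    f.denom.eval₂ (algebraMap ℚ ℂ) (n : ℂ) ≠ 0 := by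
  rw [eval₂_natCast]
  exact (map_ne_zero _).mpr h

theorem regularAt_of_denom_dvd {n : ℕ} {f : RatFunc ℚ} {q : Polynomial ℚ} (h : f.denom ∣ q)
    (hq : q.eval (n : ℚ) ≠ 0) : RegularAt n f := by
  obtain ⟨c, rfl⟩ := h
  rw [Polynomial.eval_mul] at hq
  exact left_ne_zero_of_mul hq

theorem regularAt_algebraMap (n : ℕ) (p : Polynomial ℚ) :
    RegularAt n (algebraMap (Polynomial ℚ) (RatFunc ℚ) p) := by
  simp [RegularAt, RatFunc.denom_algebraMap]

theorem regularAt_X_pow (n k : ℕ) : RegularAt n (RatFunc.X ^ k) := by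
  rw [← RatFunc.algebraMap_X, ← map_pow]
  exact regularAt_algebraMap n _

theorem value_X_pow (n k : ℕ) : value n (RatFunc.X ^ k) = (n : ℂ) ^ k := by
  rw [← RatFunc.algebraMap_X, ← map_pow, value, RatFunc.eval_algebraMap]
  simp

theorem regularAt_zero (n : ℕ) : RegularAt n 0 := by simp [RegularAt]

theorem regularAt_one (n : ℕ) : RegularAt n 1 := by simp [RegularAt]

variable {n : ℕ} {f g : RatFunc ℚ}

theorem RegularAt.add (hf : RegularAt n f) (hg : RegularAt n g) : RegularAt n (f + g) :=
  regularAt_of_denom_dvd (RatFunc.denom_add_dvd f g) (by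
    rw [Polynomial.eval_mul]; exact mul_ne_zero hf hg)

theorem RegularAt.mul (hf : RegularAt n f) (hg : RegularAt n g) : RegularAt n (f * g) :=
  regularAt_of_denom_dvd (RatFunc.denom_mul_dvd f g) (by
    rw [Polynomial.eval_mul]; exact mul_ne_zero hf hg)

theorem RegularAt.value_mul (hf : RegularAt n f) (hg : RegularAt n g) :
    value n (f * g) = value n f * value n g :=
  RatFunc.eval_mul _ _ hf.eval₂_ne_zero hg.eval₂_ne_zero

variable {ι : Type*} (s : Finset ι) {F : ι → RatFunc ℚ}

theorem regularAt_sum_and_value_sum (h : ∀ i ∈ s, RegularAt n (F i)) :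
    RegularAt n (∑ i ∈ s, F i) ∧ value n (∑ i ∈ s, F i) = ∑ i ∈ s, value n (F i) := by
  classical
  induction s using Finset.induction_on with
  | empty => exact ⟨by simpa using regularAt_zero n, by simp [value]⟩
  | insert a s ha ih =>
    obtain ⟨h1, h2⟩ := ih fun i hi => h i (Finset.mem_insert_of_mem hi)
    have h0 := h a (Finset.mem_insert_self _ _)
    rw [Finset.sum_insert ha, Finset.sum_insert ha, ← h2]
    exact ⟨h0.add h1, RatFunc.eval_add _ _ h0.eval₂_ne_zero h1.eval₂_ne_zero⟩

theorem regularAt_prod_and_value_prod (h : ∀ i ∈ s, RegularAt n (F i)) :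
    RegularAt n (∏ i ∈ s, F i) ∧ value n (∏ i ∈ s, F i) = ∏ i ∈ s, value n (F i) := by
  classical
  induction s using Finset.induction_on with
  | empty => exact ⟨by simpa using regularAt_one n, by simp [value]⟩
  | insert a s ha ih =>
    obtain ⟨h1, h2⟩ := ih fun i hi => h i (Finset.mem_insert_of_mem hi)
    have h0 := h a (Finset.mem_insert_self _ _)
    rw [Finset.prod_insert ha, Finset.prod_insert ha, ← h2]
    exact ⟨h0.mul h1, h0.value_mul h1⟩

end Regular

/-! ### Values of the Weingarten function -/

section WeingartenValue

theorem exists_injective_fin {α : Type*} [Fintype α] {n : ℕ} (hn : Fintype.card α ≤ n) :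
    ∃ ι : α → Fin n, Function.Injective ι := by
  obtain ⟨e⟩ := Function.Embedding.nonempty_of_card_le (α := α) (β := Fin n) (by simpa using hn)
  exact ⟨e, e.injective⟩

variable {α : Type*} [Fintype α] [DecidableEq α]

variable (α) in
/-- The matrix of `σ ↦ n ^ #cycles(σ)` acting by right multiplication on the group ring of
`Sym(α)`, with polynomial entries. -/
def gramMatrix : Matrix (Equiv.Perm α) (Equiv.Perm α) (Polynomial ℚ) :=
  Matrix.of fun τ σ => Polynomial.X ^ numCycles (τ⁻¹ * σ)

/-- At an integer `n ≥ #α` the matrix `gramMatrix α` is the Gram matrix of the permutations acting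
on the tensor power `(ℚⁿ)^{⊗ α}`; these are linearly independent since they move a tensor of
distinct basis vectors to distinct basis tensors. -/
theorem eval_det_gramMatrix_ne_zero {n : ℕ} (hn : Fintype.card α ≤ n) :
    (gramMatrix α).det.eval (n : ℚ) ≠ 0 := by
  obtain ⟨ι, hι⟩ := exists_injective_fin hn
  rw [← Polynomial.coe_evalRingHom, RingHom.map_det]
  intro h0
  obtain ⟨v, hv, hMv⟩ := Matrix.exists_mulVec_eq_zero_iff.mpr h0
  apply hv
  have hentry : ∀ σ τ : Equiv.Perm α, (n : ℚ) ^ numCycles (σ⁻¹ * τ) =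
      ∑ b : α → Fin n, ∑ a : α → Fin n,
        (if a = b ∘ ⇑σ⁻¹ then (1 : ℚ) else 0) * (if a = b ∘ ⇑τ⁻¹ then 1 else 0) := by
    intro σ τ
    rw [← sum_ite_comp_perm_eq]
    refine Finset.sum_congr rfl fun b _ => ?_
    simp only [ite_mul, one_mul, zero_mul, Finset.sum_ite_eq', Finset.mem_univ, if_true]
    refine if_congr ⟨fun h => ?_, fun h => ?_⟩ rfl rfl
    · funext x
      have := congrFun h (τ⁻¹ x)
      simpa using this
    · funext x
      have := congrFun h (τ x)
      simpa using this
  -- the quadratic form of the matrix at `v` is a sum of squares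
  have hsq : ∑ b : α → Fin n, ∑ a : α → Fin n,
      (∑ σ : Equiv.Perm α, v σ * if a = b ∘ ⇑σ⁻¹ then (1 : ℚ) else 0) ^ 2 = 0 := by
    have h1 : ∑ σ : Equiv.Perm α, v σ * ∑ τ, (n : ℚ) ^ numCycles (σ⁻¹ * τ) * v τ = 0 := by
      refine Finset.sum_eq_zero fun σ _ => ?_
      have := congrFun hMv σ
      simp only [Matrix.mulVec, dotProduct, gramMatrix, RingHom.mapMatrix_apply, Matrix.map_apply,
        Matrix.of_apply, Polynomial.coe_evalRingHom, Polynomial.eval_pow, Polynomial.eval_X,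
        Pi.zero_apply] at this
      rw [this, mul_zero]
    refine Eq.trans ?_ h1
    simp only [hentry, sq, Finset.sum_mul, Finset.mul_sum]
    rw [Finset.sum_congr rfl fun b _ => Finset.sum_comm, Finset.sum_comm]
    refine Finset.sum_congr rfl fun σ _ => ?_
    rw [Finset.sum_congr rfl fun b _ => Finset.sum_comm, Finset.sum_comm]
    refine Finset.sum_congr rfl fun τ _ => Finset.sum_congr rfl fun b _ =>
      Finset.sum_congr rfl fun a _ => by ring
  -- at `b = ι` and `a = ι ∘ σ⁻¹` the square is that of the single coordinate `v σ`
  funext σ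
  have h2 := (Finset.sum_eq_zero_iff_of_nonneg fun b _ =>
    Finset.sum_nonneg fun a _ => sq_nonneg _).mp hsq ι (Finset.mem_univ _)
  have h3 := (Finset.sum_eq_zero_iff_of_nonneg fun a _ => sq_nonneg _).mp h2 (ι ∘ ⇑σ⁻¹)
    (Finset.mem_univ _)
  have h4 := pow_eq_zero_iff (two_ne_zero) |>.mp h3
  rw [Finset.sum_eq_single σ] at h4
  · simpa using h4
  · intro τ _ hτ
    rw [if_neg, mul_zero]
    intro h
    apply hτ
    have h5 := hι.comp_left h
    exact (inv_injective (DFunLike.coe_injective h5)).symm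
  · simp

/-- The coefficients of the equation `Wg * cycleElement = 1` in the group ring. -/
theorem sum_weingarten_mul (σ : Equiv.Perm α) :
    ∑ τ : Equiv.Perm α, weingarten τ * RatFunc.X ^ numCycles (τ⁻¹ * σ) =
      if σ = 1 then 1 else 0 := by
  have h : ((isUnit_cycleElement α).unit⁻¹).val * cycleElement α = 1 :=
    (isUnit_cycleElement α).val_inv_mul
  have h1 := congrArg (fun z => z.coeff σ) h
  simp only [cycleElement, Finset.mul_sum, MonoidAlgebra.coeff_sum, Finset.sum_apply,
    Finsupp.coe_finsetSum, MonoidAlgebra.coeff_mul_single_apply] at h1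
  rw [← (Equiv.inv (Equiv.Perm α)).trans (Equiv.mulRight σ) |>.sum_comp] at h1
  simp only [Equiv.trans_apply, Equiv.inv_apply, Equiv.coe_mulRight, mul_inv_rev, inv_inv,
    mul_inv_cancel_left] at h1
  rw [MonoidAlgebra.one_def, MonoidAlgebra.coeff_single, Finsupp.single_apply] at h1
  simp only [eq_comm (a := (1 : Equiv.Perm α))] at h1
  exact h1

/-- By Cramer's rule the denominator of the Weingarten function divides the determinant of
`gramMatrix`. -/
theorem regularAt_weingarten {n : ℕ} (hn : Fintype.card α ≤ n) (σ : Equiv.Perm α) :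
    RegularAt n (weingarten σ) := by
  have hD := eval_det_gramMatrix_ne_zero hn
  let φ := algebraMap (Polynomial ℚ) (RatFunc ℚ)
  have hrow : Matrix.vecMul (weingarten (α := α)) (φ.mapMatrix (gramMatrix α)) =
      Pi.single 1 1 := by
    funext τ
    rw [Pi.single_apply, ← sum_weingarten_mul]
    simp [Matrix.vecMul, dotProduct, gramMatrix, φ]
  have hmul := congrArg (fun z => Matrix.vecMul z (φ.mapMatrix (gramMatrix α)).adjugate) hrow
  simp only [Matrix.vecMul_vecMul, Matrix.mul_adjugate, Matrix.single_one_vecMul] at hmul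
  have hσ := congrFun hmul σ
  rw [← RingHom.map_adjugate, ← RingHom.map_det] at hσ
  simp only [Matrix.vecMul_smul, Matrix.vecMul_one, Pi.smul_apply, smul_eq_mul, Matrix.row_apply,
    RingHom.mapMatrix_apply, Matrix.map_apply] at hσ
  have hD0 : φ (gramMatrix α).det ≠ 0 := by
    intro h
    rw [(map_eq_zero_iff φ (RatFunc.algebraMap_injective ℚ)).mp h] at hD
    simp at hD
  have hw : weingarten σ = φ ((gramMatrix α).adjugate 1 σ) / φ (gramMatrix α).det := by
    rw [eq_div_iff hD0, mul_comm, hσ]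
  rw [hw]
  exact regularAt_of_denom_dvd (RatFunc.denom_div_dvd _ _) hD

theorem sum_value_weingarten_mul {n : ℕ} (hn : Fintype.card α ≤ n) (σ : Equiv.Perm α) :
    ∑ τ : Equiv.Perm α, value n (weingarten τ) * (n : ℂ) ^ numCycles (τ⁻¹ * σ) =
      if σ = 1 then 1 else 0 := by
  have h := congrArg (value n) (sum_weingarten_mul σ)
  rw [(regularAt_sum_and_value_sum _ fun τ _ =>
    (regularAt_weingarten hn τ).mul (regularAt_X_pow n _)).2] at h
  simp only [(regularAt_weingarten hn _).value_mul (regularAt_X_pow n _), value_X_pow] at h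
  rw [h]
  split_ifs <;> simp [value]

end WeingartenValue

/-! ### Matrices that commute with tensor powers of unitary matrices -/

section TensorPower

variable {κ : Type*} [Fintype κ] {n : ℕ}

variable (κ) in
/-- The matrix of the tensor power `A^{⊗ κ}` in the basis of elementary tensors, which is indexed
by the functions `κ → Fin n`. -/
def tensorPower (A : Matrix (Fin n) (Fin n) ℂ) : Matrix (κ → Fin n) (κ → Fin n) ℂ :=
  Matrix.of fun I J => ∏ k, A (I k) (J k)

theorem tensorPower_diagonal (d : Fin n → ℂ) :
    tensorPower κ (Matrix.diagonal d) = Matrix.diagonal fun I => ∏ k, d (I k) := by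
  ext I J
  simp only [tensorPower, Matrix.of_apply, Matrix.diagonal_apply]
  split_ifs with h
  · subst h; simp
  · obtain ⟨k, hk⟩ := Function.ne_iff.mp h
    exact Finset.prod_eq_zero (Finset.mem_univ k) (if_neg hk)

theorem tensorPower_one : tensorPower κ (1 : Matrix (Fin n) (Fin n) ℂ) = 1 := by
  rw [← Matrix.diagonal_one, tensorPower_diagonal]
  simp

theorem tensorPower_conjTranspose (A : Matrix (Fin n) (Fin n) ℂ) :
    tensorPower κ A.conjTranspose = (tensorPower κ A).conjTranspose := by
  ext I J
  simp [tensorPower]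

theorem tensorPower_comp_perm (A : Matrix (Fin n) (Fin n) ℂ) (π : Equiv.Perm κ)
    (I J : κ → Fin n) : tensorPower κ A (I ∘ π) (J ∘ π) = tensorPower κ A I J :=
  Equiv.prod_comp π fun k => A (I k) (J k)

variable [DecidableEq κ]

theorem tensorPower_mul (A B : Matrix (Fin n) (Fin n) ℂ) :
    tensorPower κ (A * B) = tensorPower κ A * tensorPower κ B := by
  ext I J
  simp only [tensorPower, Matrix.of_apply, Matrix.mul_apply, Finset.prod_univ_sum,
    Fintype.piFinset_univ, Finset.prod_mul_distrib]

variable {T : Matrix (κ → Fin n) (κ → Fin n) ℂ}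

/-- A matrix that commutes with the tensor powers of the diagonal unitary matrices preserves the
weight spaces: its nonzero entries join basis tensors with the same multiset of indices. -/
theorem exists_perm_of_commute_unitary
    (hT : ∀ V : U n, Commute (tensorPower κ V.1) T) {I K : κ → Fin n} (hIK : T I K ≠ 0) :
    ∃ σ : Equiv.Perm κ, I = K ∘ σ := by
  have hcount : ∀ a, (Finset.univ.filter fun k => I k = a).card =
      (Finset.univ.filter fun k => K k = a).card := by
    intro a
    -- a root of unity of order larger than every exponent that can occur
    have hζ := Complex.isPrimitiveRoot_exp (Fintype.card κ + 1) (Nat.succ_ne_zero _)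
    set ζ := Complex.exp (2 * Real.pi * Complex.I / ((Fintype.card κ + 1 : ℕ) : ℂ)) with hζdef
    have hnorm : ‖ζ‖ = 1 := hζ.norm'_eq_one (Nat.succ_ne_zero _)
    let d : Fin n → ℂ := fun b => if b = a then ζ else 1
    have hd : Matrix.diagonal d ∈ Matrix.unitaryGroup (Fin n) ℂ := by
      rw [Matrix.mem_unitaryGroup_iff, Matrix.star_eq_conjTranspose, Matrix.diagonal_conjTranspose,
        Matrix.diagonal_mul_diagonal, ← Matrix.diagonal_one]
      congr 1
      funext b
      simp only [d, Pi.star_apply]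
      split_ifs
      · rw [RCLike.star_def, Complex.mul_conj, Complex.normSq_eq_norm_sq, hnorm]; norm_num
      · simp
    have hprod : ∀ J : κ → Fin n,
        ∏ k, d (J k) = ζ ^ (Finset.univ.filter fun k => J k = a).card := by
      intro J
      simp only [d, Finset.prod_ite, Finset.prod_const, one_pow, mul_one]
    have h := congrFun (congrFun (hT ⟨_, hd⟩).eq I) K
    simp only [tensorPower_diagonal, Matrix.diagonal_mul, Matrix.mul_diagonal] at h
    rw [mul_comm] at h
    have h' := mul_left_cancel₀ hIK h
    rw [hprod, hprod] at h'
    exact hζ.pow_inj (Nat.lt_succ_of_le (Finset.card_le_univ _))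
      (Nat.lt_succ_of_le (Finset.card_le_univ _)) h'
  have he : ∀ a, Nonempty ({k // I k = a} ≃ {k // K k = a}) := by
    intro a
    refine ⟨Fintype.equivOfCardEq ?_⟩
    rw [Fintype.card_subtype, Fintype.card_subtype, hcount a]
  let e : ∀ a, {k // I k = a} ≃ {k // K k = a} := fun a => (he a).some
  refine ⟨(Equiv.sigmaFiberEquiv I).symm.trans
    ((Equiv.sigmaCongrRight e).trans (Equiv.sigmaFiberEquiv K)), ?_⟩
  funext k
  exact ((e (I k)) ⟨k, rfl⟩).2.symm

theorem commute_tensorPower_diagonal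
    (hT : ∀ V : U n, Commute (tensorPower κ V.1) T) (d : Fin n → ℂ) :
    Commute (tensorPower κ (Matrix.diagonal d)) T := by
  change _ * _ = _ * _
  ext I K
  simp only [tensorPower_diagonal, Matrix.diagonal_mul, Matrix.mul_diagonal]
  by_cases h : T I K = 0
  · simp [h]
  · obtain ⟨σ, rfl⟩ := exists_perm_of_commute_unitary hT h
    rw [mul_comm]
    congr 1
    exact Equiv.prod_comp σ fun k => d (K k)

/-- The zero-one matrix of the map `f` has orthogonal rows, so that it is the product of a diagonal
matrix and a unitary matrix. -/
theorem exists_diagonal_mul_unitary (f : Fin n → Fin n) :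
    ∃ (d : Fin n → ℂ) (W : U n),
      (Matrix.of fun i k => if i = f k then (1 : ℂ) else 0) = Matrix.diagonal d * W.1 := by
  -- the squared norms of the rows
  let m : Fin n → ℝ := fun i => ((Finset.univ.filter fun k => i = f k).card : ℝ)
  have hm : ∀ i ∈ Set.range f, Real.sqrt (m i) ≠ 0 := by
    rintro _ ⟨k, rfl⟩
    refine (Real.sqrt_pos.mpr (Nat.cast_pos.mpr (Finset.card_pos.mpr ⟨k, ?_⟩))).ne'
    simp
  let v : Fin n → EuclideanSpace ℂ (Fin n) := fun i =>
    WithLp.toLp 2 fun k => if i = f k then ((Real.sqrt (m i))⁻¹ : ℂ) else 0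
  have hv : Orthonormal ℂ ((Set.range f).domRestrict v) := by
    rw [orthonormal_iff_ite]
    rintro ⟨i, hi⟩ ⟨j, hj⟩
    have hinner : inner ℂ (v i) (v j) = if i = j then (1 : ℂ) else 0 := by
      rw [PiLp.inner_apply]
      simp only [v, RCLike.inner_apply]
      split_ifs with hij
      · subst hij
        have hterm : ∀ k, ((if i = f k then ((Real.sqrt (m i))⁻¹ : ℂ) else 0) *
            (starRingEnd ℂ) (if i = f k then ((Real.sqrt (m i))⁻¹ : ℂ) else 0)) =
            if i = f k then ((m i : ℂ))⁻¹ else 0 := by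
          intro k
          split_ifs
          · rw [map_inv₀, Complex.conj_ofReal, ← mul_inv, ← Complex.ofReal_mul,
              Real.mul_self_sqrt (Nat.cast_nonneg _)]
          · simp
        have hmi : (m i : ℂ) ≠ 0 := by
          intro h
          apply hm i hi
          rw [Complex.ofReal_eq_zero.mp h, Real.sqrt_zero]
        rw [Finset.sum_congr rfl fun k _ => hterm k, ← Finset.sum_filter, Finset.sum_const,
          nsmul_eq_mul]
        simp only [m, Complex.ofReal_natCast] at hmi ⊢
        exact mul_inv_cancel₀ hmi
      · refine Finset.sum_eq_zero fun k _ => ?_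
        by_cases h1 : i = f k
        · rw [if_neg (c := j = f k) (fun h2 => hij (h1.trans h2.symm)), zero_mul]
        · simp [h1]
    simpa [Set.domRestrict, Subtype.mk.injEq] using hinner
  -- the normalized nonzero rows are completed to an orthonormal basis
  obtain ⟨b, hb⟩ := hv.exists_orthonormalBasis_extension_of_card_eq (by simp)
  have hW : (Matrix.of fun i k => b i k) ∈ Matrix.unitaryGroup (Fin n) ℂ := by
    rw [Matrix.mem_unitaryGroup_iff]
    ext i j
    have h := orthonormal_iff_ite.mp b.orthonormal j i
    rw [PiLp.inner_apply] at h
    simp only [RCLike.inner_apply] at h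
    simp only [Matrix.mul_apply, Matrix.of_apply, Matrix.star_apply, Matrix.one_apply,
      RCLike.star_def]
    rw [h]
    exact if_congr eq_comm rfl rfl
  refine ⟨fun i => (Real.sqrt (m i) : ℂ), ⟨_, hW⟩, ?_⟩
  ext i k
  simp only [Matrix.diagonal_mul, Matrix.of_apply]
  by_cases hi : i ∈ Set.range f
  · rw [hb i hi]
    simp only [v]
    split_ifs
    · rw [mul_inv_cancel₀]
      exact_mod_cast hm i hi
    · simp
  · have hmi : m i = 0 := by
      simp only [m, Nat.cast_eq_zero, Finset.card_eq_zero, Finset.filter_eq_empty_iff]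
      exact fun k _ h => hi ⟨k, h.symm⟩
    rw [if_neg fun h => hi ⟨k, h.symm⟩, hmi]
    simp

/-- The part of Schur–Weyl duality in which the dimension is at least the number of tensor
factors. A matrix that commutes with the tensor powers of unitary matrices commutes with the tensor
power of every zero-one matrix of a map `f : Fin n → Fin n`. The tensor `ι` of distinct basis vectors
can be moved to every basis tensor by such a matrix, so that the column of `ι`, which has entries
only at rearrangements of `ι`, determines the matrix. -/
theorem eq_sum_perm_of_commute_unitary (hT : ∀ V : U n, Commute (tensorPower κ V.1) T)
    {ι : κ → Fin n} (hι : Function.Injective ι) (I J : κ → Fin n) :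
    T I J = ∑ σ : Equiv.Perm κ, T (ι ∘ σ) ι * if I = J ∘ σ then 1 else 0 := by
  -- the map `f` moves the tensor `ι` to `J`
  obtain ⟨f, hf⟩ : ∃ f : Fin n → Fin n, f ∘ ι = J := by
    rcases isEmpty_or_nonempty κ with hκ | ⟨⟨k⟩⟩
    · exact ⟨id, Subsingleton.elim _ _⟩
    · exact ⟨Function.extend ι J fun _ => J k, Function.extend_comp hι _ _⟩
  obtain ⟨d, W, hdW⟩ := exists_diagonal_mul_unitary f
  set A : Matrix (Fin n) (Fin n) ℂ := Matrix.of fun i k => if i = f k then (1 : ℂ) else 0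
  have hA : ∀ I K : κ → Fin n, tensorPower κ A I K = if I = f ∘ K then 1 else 0 := by
    intro I K
    simp only [tensorPower, A, Matrix.of_apply, Fintype.prod_boole, funext_iff, Function.comp_apply]
  have hcomm : Commute (tensorPower κ A) T := by
    rw [hdW, tensorPower_mul]
    exact (commute_tensorPower_diagonal hT d).mul_left (hT W)
  have h := congrFun (congrFun hcomm.eq I) ι
  simp only [Matrix.mul_apply, hA, hf] at h
  have hJ : ∑ K, T I K * (if K = J then 1 else 0) = T I J := by simp
  rw [← hJ, ← h, ← Finset.sum_subset (Finset.subset_univ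
    (Finset.univ.image fun σ : Equiv.Perm κ => ι ∘ σ)), Finset.sum_image]
  · refine Finset.sum_congr rfl fun σ _ => ?_
    rw [← Function.comp_assoc, hf, mul_comm]
  · intro σ _ τ _ hστ
    exact DFunLike.coe_injective (hι.comp_left hστ)
  · intro K _ hK
    by_contra h0
    obtain ⟨σ, hσ⟩ := exists_perm_of_commute_unitary hT (right_ne_zero_of_mul h0)
    exact hK (Finset.mem_image.mpr ⟨σ, Finset.mem_univ _, hσ.symm⟩)

end TensorPower

/-! ### Moments of the Haar measure -/

section HaarIntegral

instance (n : ℕ) : (haarU n).IsHaarMeasure :=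
  inferInstanceAs (Measure.haarMeasure _).IsHaarMeasure

/-- Compact groups are unimodular: a right translate of the measure is a Haar measure of total
mass one. -/
instance (n : ℕ) : (haarU n).IsMulRightInvariant where
  map_mul_right_eq_self g := by
    have : IsProbabilityMeasure (Measure.map (· * g) (haarU n)) :=
      Measure.isProbabilityMeasure_map (by fun_prop)
    exact Measure.isHaarMeasure_eq_of_isProbabilityMeasure _ _

theorem integrable_haarU {n : ℕ} {F : U n → ℂ} (hF : Continuous F) : Integrable F (haarU n) :=
  hF.integrable_of_hasCompactSupport (HasCompactSupport.of_compactSpace _)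

variable {κ : Type*} [Fintype κ] {n : ℕ}

/-- The integral of a product of matrix entries of a Haar unitary matrix and of conjugates of
matrix entries. -/
def haarMoment (a b c d : κ → Fin n) : ℂ :=
  ∫ V : U n, tensorPower κ V.1 a b * (tensorPower κ V.1).conjTranspose d c ∂(haarU n)

theorem continuous_tensorPower_apply (a b : κ → Fin n) :
    Continuous fun V : U n => tensorPower κ V.1 a b :=
  continuous_finsetProd _ fun k _ => continuous_subtype_val.matrix_elem (a k) (b k)

theorem continuous_tensorPower_conjTranspose_apply (a b : κ → Fin n) :
    Continuous fun V : U n => (tensorPower κ V.1).conjTranspose a b :=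
  (continuous_tensorPower_apply b a).star

theorem continuous_haarMoment_integrand (a b c d : κ → Fin n) :
    Continuous fun V : U n => tensorPower κ V.1 a b * (tensorPower κ V.1).conjTranspose d c :=
  (continuous_tensorPower_apply a b).mul (continuous_tensorPower_conjTranspose_apply d c)

variable [DecidableEq κ]

theorem tensorPower_conjTranspose_mul_self (V : U n) :
    (tensorPower κ V.1).conjTranspose * tensorPower κ V.1 = 1 := by
  rw [← tensorPower_conjTranspose, ← tensorPower_mul, ← Matrix.star_eq_conjTranspose,
    Unitary.coe_star_mul_self, tensorPower_one]

theorem tensorPower_mul_conjTranspose_self (V : U n) :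
    tensorPower κ V.1 * (tensorPower κ V.1).conjTranspose = 1 := by
  rw [← tensorPower_conjTranspose, ← tensorPower_mul, ← Matrix.star_eq_conjTranspose,
    Matrix.mem_unitaryGroup_iff.mp V.2, tensorPower_one]

theorem commute_haarMoment_left (b d : κ → Fin n) (V : U n) :
    Commute (tensorPower κ V.1) (Matrix.of fun a c => haarMoment a b c d) := by
  set T : Matrix (κ → Fin n) (κ → Fin n) ℂ := Matrix.of fun a c => haarMoment a b c d with hTdef
  have hT : T = tensorPower κ V.1 * T * (tensorPower κ V.1).conjTranspose := by
    ext a c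
    simp only [Matrix.mul_apply, hTdef, Matrix.of_apply, Finset.sum_mul]
    conv_lhs => rw [haarMoment, ← integral_mul_left_eq_self _ V]
    have hexp : ∀ W : U n, tensorPower κ (V * W).1 a b *
        (tensorPower κ (V * W).1).conjTranspose d c = ∑ c' : κ → Fin n, ∑ a' : κ → Fin n,
        tensorPower κ V.1 a a' * (tensorPower κ W.1 a' b *
          (tensorPower κ W.1).conjTranspose d c') * (tensorPower κ V.1).conjTranspose c' c := by
      intro W
      rw [Submonoid.coe_mul, tensorPower_mul, Matrix.conjTranspose_mul, Matrix.mul_apply,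
        Matrix.mul_apply, Finset.sum_mul_sum, Finset.sum_comm]
      refine Finset.sum_congr rfl fun c' _ => Finset.sum_congr rfl fun a' _ => by ring
    simp_rw [hexp]
    have hint : ∀ a' c' : κ → Fin n, Integrable (fun W : U n => tensorPower κ V.1 a a' *
        (tensorPower κ W.1 a' b * (tensorPower κ W.1).conjTranspose d c') *
          (tensorPower κ V.1).conjTranspose c' c) (haarU n) := fun a' c' =>
      ((integrable_haarU (continuous_haarMoment_integrand a' b c' d)).const_mul _).mul_const _
    rw [integral_finsetSum _ fun c' _ => integrable_finsetSum _ fun a' _ => hint a' c']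
    refine Finset.sum_congr rfl fun c' _ => ?_
    rw [integral_finsetSum _ fun a' _ => hint a' c']
    refine Finset.sum_congr rfl fun a' _ => ?_
    rw [integral_mul_const, integral_const_mul, haarMoment]
  change _ * T = T * _
  conv_rhs => rw [hT]
  rw [Matrix.mul_assoc _ _ (tensorPower κ V.1), tensorPower_conjTranspose_mul_self, Matrix.mul_one]

theorem commute_haarMoment_right (a c : κ → Fin n) (V : U n) :
    Commute (tensorPower κ V.1) (Matrix.of fun d b => haarMoment a b c d) := by
  set T : Matrix (κ → Fin n) (κ → Fin n) ℂ := Matrix.of fun d b => haarMoment a b c d with hTdef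
  have hT : T = (tensorPower κ V.1).conjTranspose * T * tensorPower κ V.1 := by
    ext d b
    simp only [Matrix.mul_apply, hTdef, Matrix.of_apply, Finset.sum_mul]
    conv_lhs => rw [haarMoment, ← integral_mul_right_eq_self _ V]
    have hexp : ∀ W : U n, tensorPower κ (W * V).1 a b *
        (tensorPower κ (W * V).1).conjTranspose d c = ∑ b' : κ → Fin n, ∑ d' : κ → Fin n,
        (tensorPower κ V.1).conjTranspose d d' * (tensorPower κ W.1 a b' *
          (tensorPower κ W.1).conjTranspose d' c) * tensorPower κ V.1 b' b := by
      intro W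
      rw [Submonoid.coe_mul, tensorPower_mul, Matrix.conjTranspose_mul, Matrix.mul_apply,
        Matrix.mul_apply, Finset.sum_mul_sum]
      refine Finset.sum_congr rfl fun c' _ => Finset.sum_congr rfl fun a' _ => by ring
    simp_rw [hexp]
    have hint : ∀ b' d' : κ → Fin n, Integrable (fun W : U n =>
        (tensorPower κ V.1).conjTranspose d d' * (tensorPower κ W.1 a b' *
          (tensorPower κ W.1).conjTranspose d' c) * tensorPower κ V.1 b' b) (haarU n) :=
      fun b' d' =>
      ((integrable_haarU (continuous_haarMoment_integrand a b' c d')).const_mul _).mul_const _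
    rw [integral_finsetSum _ fun b' _ => integrable_finsetSum _ fun d' _ => hint b' d']
    refine Finset.sum_congr rfl fun b' _ => ?_
    rw [integral_finsetSum _ fun d' _ => hint b' d']
    refine Finset.sum_congr rfl fun d' _ => ?_
    rw [integral_mul_const, integral_const_mul, haarMoment]
  change _ * T = T * _
  conv_lhs => rw [hT]
  rw [← Matrix.mul_assoc, ← Matrix.mul_assoc, tensorPower_mul_conjTranspose_self, Matrix.one_mul]

/-- Contracting the column indices along `π` uses the orthogonality of the rows of a unitary
matrix. -/
theorem sum_haarMoment_comp_perm (a c : κ → Fin n) (π : Equiv.Perm κ) :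
    ∑ b : κ → Fin n, haarMoment a b c (b ∘ π) = if a ∘ π = c then 1 else 0 := by
  simp only [haarMoment]
  rw [← integral_finsetSum _ fun b _ =>
    integrable_haarU (continuous_haarMoment_integrand a b c (b ∘ π))]
  have h : ∀ V : U n, ∑ b : κ → Fin n, tensorPower κ V.1 a b *
      (tensorPower κ V.1).conjTranspose (b ∘ π) c = if a ∘ π = c then 1 else 0 := by
    intro V
    have h1 := congrFun (congrFun (tensorPower_mul_conjTranspose_self (κ := κ) V) (a ∘ π)) c
    rw [Matrix.mul_apply, Matrix.one_apply] at h1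
    rw [← h1, ← (π.arrowCongr (Equiv.refl (Fin n))).sum_comp]
    refine Finset.sum_congr rfl fun b _ => ?_
    rw [← tensorPower_comp_perm V.1 π]
    have hb : ((π.arrowCongr (Equiv.refl (Fin n))) b) ∘ π = b := by
      funext k; simp [Equiv.arrowCongr]
    rw [hb]
  simp_rw [h]
  simp

/-- Apply `eq_sum_perm_of_commute_unitary` to the row indices, then to the column indices. -/
theorem haarMoment_eq_sum_perm {ι : κ → Fin n} (hι : Function.Injective ι) (a b c d : κ → Fin n) :
    haarMoment a b c d = ∑ σ : Equiv.Perm κ, ∑ τ : Equiv.Perm κ,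
      haarMoment (ι ∘ σ) ι ι (ι ∘ τ) * (if a = c ∘ σ then 1 else 0) *
        (if d = b ∘ τ then 1 else 0) := by
  have h1 := eq_sum_perm_of_commute_unitary (commute_haarMoment_left b d) hι a c
  simp only [Matrix.of_apply] at h1
  rw [h1]
  refine Finset.sum_congr rfl fun σ _ => ?_
  have h2 := eq_sum_perm_of_commute_unitary (commute_haarMoment_right (ι ∘ σ) ι) hι d b
  simp only [Matrix.of_apply] at h2
  rw [h2, Finset.sum_mul]
  exact Finset.sum_congr rfl fun τ _ => by ring

/-- The coefficients of the expansion `haarMoment_eq_sum_perm` are determined by the contraction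
`sum_haarMoment_comp_perm`: they solve the linear system that defines the Weingarten function. -/
theorem haarMoment_coefficient (hn : Fintype.card κ ≤ n) {ι : κ → Fin n}
    (hι : Function.Injective ι) (ρ τ : Equiv.Perm κ) :
    haarMoment (ι ∘ ρ) ι ι (ι ∘ τ) = value n (weingarten (ρ⁻¹ * τ⁻¹)) := by
  have hinj : ∀ {σ σ' : Equiv.Perm κ}, ι ∘ σ = ι ∘ σ' ↔ σ = σ' := fun {σ σ'} =>
    ⟨fun h => DFunLike.coe_injective (hι.comp_left h), fun h => h ▸ rfl⟩
  have hcount : ∀ τ π : Equiv.Perm κ,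
      (∑ b : κ → Fin n, if b ∘ π = b ∘ τ then (1 : ℂ) else 0) =
        (n : ℂ) ^ numCycles (τ⁻¹ * π) := by
    intro τ π
    rw [numCycles_mul_comm, ← sum_ite_comp_perm_eq]
    refine Finset.sum_congr rfl fun b _ => if_congr ⟨fun h => ?_, fun h => ?_⟩ rfl rfl
    · funext x
      simpa using congrFun h (τ⁻¹ x)
    · funext x
      simpa using congrFun h (τ x)
  have hY : ∀ π : Equiv.Perm κ, ∑ τ : Equiv.Perm κ,
      haarMoment (ι ∘ ρ) ι ι (ι ∘ τ) * (n : ℂ) ^ numCycles (τ⁻¹ * π) =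
        if ρ * π = 1 then 1 else 0 := by
    intro π
    have h := sum_haarMoment_comp_perm (ι ∘ ρ) ι π
    have hρ : (ι ∘ ρ) ∘ π = ι ↔ ρ * π = 1 := by
      rw [← hinj]
      exact Iff.rfl
    rw [if_congr hρ rfl rfl] at h
    rw [← h]
    have hb : ∀ b : κ → Fin n, haarMoment (ι ∘ ρ) b ι (b ∘ π) = ∑ τ : Equiv.Perm κ,
        haarMoment (ι ∘ ρ) ι ι (ι ∘ τ) * if b ∘ π = b ∘ τ then 1 else 0 := by
      intro b
      rw [haarMoment_eq_sum_perm hι, Finset.sum_eq_single ρ]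
      · simp
      · intro σ _ hσ
        simp [hinj, hσ.symm]
      · simp
    simp_rw [hb]
    rw [Finset.sum_comm]
    refine Finset.sum_congr rfl fun τ _ => ?_
    rw [← Finset.mul_sum, hcount]
  have hW : ∀ π : Equiv.Perm κ, ∑ τ : Equiv.Perm κ,
      value n (weingarten (ρ⁻¹ * τ⁻¹)) * (n : ℂ) ^ numCycles (τ⁻¹ * π) =
        if ρ * π = 1 then 1 else 0 := by
    intro π
    rw [← ((Equiv.inv (Equiv.Perm κ)).trans (Equiv.mulRight ρ⁻¹)).sum_comp]
    have h := sum_value_weingarten_mul hn (π * ρ)⁻¹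
    rw [if_congr (inv_eq_one.trans mul_eq_one_comm) rfl rfl] at h
    rw [← h]
    refine Finset.sum_congr rfl fun s _ => ?_
    simp only [Equiv.trans_apply, Equiv.inv_apply, Equiv.coe_mulRight, mul_inv_rev, inv_inv,
      inv_mul_cancel_left]
    congr 2
    rw [mul_assoc, numCycles_mul_comm, ← numCycles_inv, mul_inv_rev, mul_inv_rev, ← mul_assoc,
      numCycles_mul_comm]
  have hdet : (((gramMatrix κ).map
      (Polynomial.eval₂RingHom (algebraMap ℚ ℂ) (n : ℂ))).det) ≠ 0 := by
    rw [← RingHom.mapMatrix_apply, ← RingHom.map_det, Polynomial.coe_eval₂RingHom, eval₂_natCast]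
    exact (map_ne_zero _).mpr (eval_det_gramMatrix_ne_zero hn)
  have hzero := Matrix.eq_zero_of_vecMul_eq_zero hdet
    (v := fun τ => haarMoment (ι ∘ ρ) ι ι (ι ∘ τ) - value n (weingarten (ρ⁻¹ * τ⁻¹))) (by
      funext π
      simp only [Matrix.vecMul, dotProduct, Matrix.map_apply, gramMatrix, Matrix.of_apply,
        Polynomial.coe_eval₂RingHom, Polynomial.eval₂_pow, Polynomial.eval₂_X, sub_mul,
        Finset.sum_sub_distrib, hY, hW, sub_self, Pi.zero_apply])
  exact sub_eq_zero.mp (congrFun hzero τ)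

end HaarIntegral

/-! ### The Weingarten formula for two matched index sets -/

section Matchings

variable {P N : Type*} [Fintype P] [DecidableEq P] [Fintype N] [DecidableEq N] {n : ℕ}

/-- The Weingarten formula for the moments of the entries of a Haar unitary matrix. -/
theorem integral_prod_entries (e : P ≃ N) (hn : Fintype.card P ≤ n) (a b : P → Fin n)
    (c d : N → Fin n) :
    ∫ V : U n, (∏ p, V.1 (a p) (b p)) * ∏ q, star (V.1 (c q) (d q)) ∂(haarU n) =
      ∑ σ : P ≃ N, ∑ τ : P ≃ N, value n (weingarten (τ.trans σ.symm)) *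
        ((if a = c ∘ σ then 1 else 0) * (if b = d ∘ τ then 1 else 0)) := by
  obtain ⟨ι, hι⟩ := exists_injective_fin hn
  have h0 : ∀ V : U n, (∏ p, V.1 (a p) (b p)) * ∏ q, star (V.1 (c q) (d q)) =
      tensorPower P V.1 a b * (tensorPower P V.1).conjTranspose (d ∘ e) (c ∘ e) := by
    intro V
    simp only [tensorPower, Matrix.conjTranspose_apply, Matrix.of_apply, star_prod,
      Function.comp_apply]
    rw [Equiv.prod_comp e fun q => star (V.1 (c q) (d q))]
  simp_rw [h0]
  change haarMoment a b (c ∘ e) (d ∘ e) = _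
  rw [haarMoment_eq_sum_perm hι, ← ((Equiv.refl P).equivCongr e).sum_comp]
  refine Finset.sum_congr rfl fun σ _ => ?_
  rw [← ((Equiv.inv (Equiv.Perm P)).trans ((Equiv.refl P).equivCongr e)).sum_comp]
  refine Finset.sum_congr rfl fun τ _ => ?_
  rw [haarMoment_coefficient hn hι, mul_assoc]
  congr 1
  · congr 2
    ext p
    simp [Equiv.Perm.mul_apply, Equiv.equivCongr]
  · congr 1
    refine if_congr ⟨fun h => ?_, fun h => ?_⟩ rfl rfl
    · funext p
      simpa [Equiv.equivCongr] using (congrFun h (τ⁻¹ p)).symm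
    · funext p
      simpa [Equiv.equivCongr] using (congrFun h (τ p)).symm

end Matchings

/-! ### Expansion of the traces -/

section TraceExpansion

variable {n : ℕ}

/-- An entry of a product of matrices is a sum over walks from `a` to `b`; the index `k` runs from
`Fin.cons a f k` to `Fin.snoc f b k`. -/
theorem prod_ofFn_apply (m : ℕ) (A : Fin (m + 1) → Matrix (Fin n) (Fin n) ℂ) (a b : Fin n) :
    (List.ofFn A).prod a b = ∑ f : Fin m → Fin n,
      ∏ k, A k (Fin.cons (α := fun _ => Fin n) a f k) (Fin.snoc (α := fun _ => Fin n) f b k) := by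
  induction m generalizing a with
  | zero => simp [Fin.snoc]
  | succ m ih =>
    rw [List.ofFn_succ, List.prod_cons, Matrix.mul_apply,
      ← (Fin.consEquiv fun _ : Fin (m + 1) => Fin n).sum_comp, Fintype.sum_prod_type]
    refine Finset.sum_congr rfl fun x _ => ?_
    rw [ih, Finset.mul_sum]
    refine Finset.sum_congr rfl fun f _ => ?_
    rw [Fin.prod_univ_succ (n := m + 1)]
    have hs : Fin.snoc (α := fun _ => Fin n) ((Fin.consEquiv fun _ : Fin (m + 1) => Fin n) (x, f)) b
        = Fin.cons (α := fun _ => Fin n) x (Fin.snoc (α := fun _ => Fin n) f b) :=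
      (Fin.cons_snoc_eq_snoc_cons x f b).symm
    simp only [hs, Fin.consEquiv_apply, Fin.cons_zero, Fin.cons_succ]

/-- The assumption `m ≠ 0` is needed: the trace of the empty product is `n`, but there is only one
empty walk. -/
theorem trace_prod_ofFn {m : ℕ} (hm : m ≠ 0) (A : Fin m → Matrix (Fin n) (Fin n) ℂ) :
    (List.ofFn A).prod.trace = ∑ f : Fin m → Fin n, ∏ k, A k (f k) (f (finRotate m k)) := by
  obtain ⟨m, rfl⟩ := Nat.exists_eq_succ_of_ne_zero hm
  rw [← (Fin.consEquiv fun _ : Fin (m + 1) => Fin n).sum_comp, Fintype.sum_prod_type]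
  refine Finset.sum_congr rfl fun a _ => ?_
  rw [Matrix.diag_apply, prod_ofFn_apply]
  simp only [Fin.snoc_eq_cons_rotate]
  rfl

variable {r ℓ : ℕ} (w : Fin ℓ → FreeGroup (Fin r))

/-- The unitary matrix that is substituted for a letter. -/
def letterMatrix (u : Fin r → U n) (x : Fin r × Bool) : U n := bif x.2 then u x.1 else (u x.1)⁻¹

theorem trace_lift_eq (u : Fin r → U n) (v : FreeGroup (Fin r)) :
    Matrix.trace (FreeGroup.lift u v : U n).1 = (if v = 1 then (n : ℂ) else 1) *
      ∑ f : Fin v.toWord.length → Fin n,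
        ∏ k, (letterMatrix u (v.toWord.get k)).1 (f k) (f (finRotate _ k)) := by
  have hlift : (FreeGroup.lift u v : U n).1 =
      (List.ofFn fun k => (letterMatrix u (v.toWord.get k)).1).prod := by
    conv_lhs => rw [← FreeGroup.mk_toWord (x := v), FreeGroup.lift_mk]
    change (Submonoid.subtype (Matrix.unitaryGroup (Fin n) ℂ)) _ = _
    rw [map_list_prod, List.map_map]
    congr 1
    conv_lhs => rw [← List.ofFn_get v.toWord, List.map_ofFn]
    rfl
  split_ifs with hv
  · subst hv
    have : IsEmpty (Fin (1 : FreeGroup (Fin r)).toWord.length) := by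
      rw [FreeGroup.toWord_one]; exact Fin.isEmpty
    rw [Fintype.sum_unique, Fintype.prod_empty]
    simp
  · rw [hlift, trace_prod_ofFn, one_mul]
    rw [Ne, List.length_eq_zero_iff, FreeGroup.toWord_eq_nil_iff]
    exact hv

/-- The contribution of the letters `x_i^{±1}` to the expansion of the traces, when `f` assigns
values to the indices. -/
def generatorFactor (f : Letter w → Fin n) (i : Fin r) (V : U n) : ℂ :=
  (∏ p : Pos w i, V.1 (f p.1) (f (next w p.1))) *
    ∏ q : Neg w i, star (V.1 (f (next w q.1)) (f q.1))

theorem traceProd_eq_sum (u : Fin r → U n) :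
    traceProd w n u = (n : ℂ) ^ numTrivial w *
      ∑ f : Letter w → Fin n, ∏ i, generatorFactor w f i (u i) := by
  simp only [traceProd, trace_lift_eq, Finset.prod_mul_distrib]
  congr 1
  · rw [Finset.prod_ite, Finset.prod_const_one, mul_one, Finset.prod_const, numTrivial,
      Fintype.card_subtype]
  · rw [Finset.prod_univ_sum, Fintype.piFinset_univ,
      ← (Equiv.piCurry fun (j : Fin ℓ) (_ : Fin (w j).toWord.length) => Fin n).sum_comp]
    refine Finset.sum_congr rfl fun f _ => ?_
    have h1 := Fintype.prod_sigma' fun (j : Fin ℓ) (k : Fin (w j).toWord.length) =>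
      (letterMatrix u (letterAt w ⟨j, k⟩)).1 (f ⟨j, k⟩) (f (next w ⟨j, k⟩))
    refine h1.symm.trans ?_
    rw [← Fintype.prod_fiberwise (letterAt w), Fintype.prod_prod_type]
    refine Finset.prod_congr rfl fun i _ => ?_
    rw [Fintype.prod_bool, generatorFactor]
    congr 1
    · refine Finset.prod_congr rfl fun p _ => ?_
      rw [show letterAt w ⟨p.1.1, p.1.2⟩ = (i, true) from p.2]
      rfl
    · refine Finset.prod_congr rfl fun q _ => ?_
      rw [show letterAt w ⟨q.1.1, q.1.2⟩ = (i, false) from q.2]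
      rfl

theorem continuous_generatorFactor (f : Letter w → Fin n) (i : Fin r) :
    Continuous (generatorFactor w f i) :=
  (continuous_finsetProd _ fun _ _ => continuous_subtype_val.matrix_elem _ _).mul
    (continuous_finsetProd _ fun _ _ => (continuous_subtype_val.matrix_elem _ _).star)

theorem expectedTrace_eq_sum (n : ℕ) :
    expectedTrace w n = (n : ℂ) ^ numTrivial w *
      ∑ f : Letter w → Fin n, ∏ i, ∫ V, generatorFactor w f i V ∂(haarU n) := by
  simp only [expectedTrace, traceProd_eq_sum]
  rw [integral_const_mul, integral_finsetSum]
  · simp only [integral_fintype_prod_eq_prod]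
  · intro f _
    exact Integrable.fintype_prod fun i => integrable_haarU (continuous_generatorFactor w f i)

theorem sum_indexRel (n : ℕ) (σ τ : ∀ i, Bij w i) :
    (∑ f : Letter w → Fin n, ∏ i,
      (if (fun p : Pos w i => f p.1) = (fun q : Neg w i => f (next w q.1)) ∘ σ i
        then (1 : ℂ) else 0) *
      (if (fun p : Pos w i => f (next w p.1)) = (fun q : Neg w i => f q.1) ∘ τ i
        then 1 else 0)) = (n : ℂ) ^ numBlocks w σ τ := by
  classical
  have h : ∀ f : Letter w → Fin n, (∏ i,
      (if (fun p : Pos w i => f p.1) = (fun q : Neg w i => f (next w q.1)) ∘ σ i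
        then (1 : ℂ) else 0) *
      (if (fun p : Pos w i => f (next w p.1)) = (fun q : Neg w i => f q.1) ∘ τ i
        then 1 else 0)) = if ∀ x y, IndexRel w σ τ x y → f x = f y then 1 else 0 := by
    intro f
    simp only [mul_ite, mul_one, mul_zero, ← ite_and]
    rw [Finset.prod_boole]
    congr 1
    refine propext ⟨fun h => ?_, fun h i _ => ⟨?_, ?_⟩⟩
    · rintro _ _ (⟨i, p⟩ | ⟨i, p⟩)
      · exact congrFun (h i (Finset.mem_univ i)).2 p
      · exact congrFun (h i (Finset.mem_univ i)).1 p
    · funext p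
      exact h _ _ (.col i p)
    · funext p
      exact h _ _ (.row i p)
  simp_rw [h]
  rw [Finset.sum_boole, ← Fintype.card_subtype, ← Nat.card_eq_fintype_card,
    card_factoring_through_quot, numBlocks, Nat.cast_pow]

theorem expectedTrace_eq_sum_weingarten (hw : Balanced w) {n : ℕ}
    (hn : ∀ i, Fintype.card (Pos w i) ≤ n) :
    expectedTrace w n = ∑ σ : (∀ i, Bij w i), ∑ τ : (∀ i, Bij w i),
      (∏ i, value n (weingarten ((τ i).trans (σ i).symm))) *
        (n : ℂ) ^ (numBlocks w σ τ + numTrivial w) := by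
  rw [expectedTrace_eq_sum]
  have h : ∀ (f : Letter w → Fin n) (i : Fin r), ∫ V, generatorFactor w f i V ∂(haarU n) = _ :=
    fun f i => integral_prod_entries (Fintype.equivOfCardEq (hw i)) (hn i) (fun p => f p.1)
      (fun p => f (next w p.1)) (fun q => f (next w q.1)) fun q => f q.1
  simp_rw [h, Finset.prod_univ_sum, Fintype.piFinset_univ, Finset.prod_mul_distrib]
  rw [Finset.sum_comm, Finset.mul_sum]
  refine Finset.sum_congr rfl fun σ _ => ?_
  rw [Finset.sum_comm, Finset.mul_sum]
  refine Finset.sum_congr rfl fun τ _ => ?_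
  rw [← Finset.mul_sum, pow_add, ← sum_indexRel]
  simp only [Finset.prod_mul_distrib]
  ring

end TraceExpansion

end WordTrace

end

theorem mainTheorem11 {r ℓ : ℕ} (w : Fin ℓ → FreeGroup (Fin r)) (hw : WordTrace.Balanced w) :
    -- the explicit formula, in which no Weingarten function has a pole at `n`
    (∀ n : ℕ, (∀ i, Fintype.card (WordTrace.Pos w i) ≤ n) →
      (∀ (i : Fin r) (σ τ : WordTrace.Bij w i),
        (WordTrace.weingarten (τ.trans σ.symm)).denom.eval (n : ℚ) ≠ 0) ∧
      WordTrace.expectedTrace w n =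
        ∑ σ : (∀ i, WordTrace.Bij w i), ∑ τ : (∀ i, WordTrace.Bij w i),
          (∏ i, (WordTrace.weingarten ((τ i).trans (σ i).symm)).eval (algebraMap ℚ ℂ) (n : ℂ)) *
            (n : ℂ) ^ (WordTrace.numBlocks w σ τ + WordTrace.numTrivial w)) ∧
    -- one rational function with rational coefficients, with no pole at these `n`
    (∃ R : RatFunc ℚ, ∀ n : ℕ, (∀ i, Fintype.card (WordTrace.Pos w i) ≤ n) →
      R.denom.eval (n : ℚ) ≠ 0 ∧
      WordTrace.expectedTrace w n = R.eval (algebraMap ℚ ℂ) (n : ℂ)) := by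
  refine ⟨fun n hn => ⟨fun i σ τ => WordTrace.regularAt_weingarten (hn i) _,
    WordTrace.expectedTrace_eq_sum_weingarten w hw hn⟩,
    ∑ σ : (∀ i, WordTrace.Bij w i), ∑ τ : (∀ i, WordTrace.Bij w i),
      (∏ i, WordTrace.weingarten ((τ i).trans (σ i).symm)) *
        RatFunc.X ^ (WordTrace.numBlocks w σ τ + WordTrace.numTrivial w), fun n hn => ?_⟩
  have hprod := fun σ τ : (∀ i, WordTrace.Bij w i) =>
    WordTrace.regularAt_prod_and_value_prod (n := n) Finset.univ
      (F := fun i => WordTrace.weingarten ((τ i).trans (σ i).symm))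
      fun i _ => WordTrace.regularAt_weingarten (hn i) _
  have hterm := fun σ τ : (∀ i, WordTrace.Bij w i) => (hprod σ τ).1.mul
    (WordTrace.regularAt_X_pow n (WordTrace.numBlocks w σ τ + WordTrace.numTrivial w))
  have hinner := fun σ : (∀ i, WordTrace.Bij w i) =>
    WordTrace.regularAt_sum_and_value_sum Finset.univ fun τ _ => hterm σ τ
  have houter := WordTrace.regularAt_sum_and_value_sum Finset.univ fun σ _ => (hinner σ).1
  refine ⟨houter.1, ?_⟩
  rw [WordTrace.expectedTrace_eq_sum_weingarten w hw hn]
  refine Eq.trans ?_ houter.2.symm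
  refine Finset.sum_congr rfl fun σ _ => ?_
  rw [(hinner σ).2]
  refine Finset.sum_congr rfl fun τ _ => ?_
  rw [(hprod σ τ).1.value_mul (WordTrace.regularAt_X_pow n _), (hprod σ τ).2,
    WordTrace.value_X_pow]
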